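/- Let $C=\{0,1\}^{\mathbb N}$ be the Cantor space with the product topology and the compatible metric $d(\sigma,\sigma)=0$, $d(\sigma,\tau)=1/n$ for $\sigma\ne\tau$, where $n\ge 1$ is least with $\sigma(n)\neq\tau(n)$. Let $\mathcal C(C)$ be the space of all continuous maps $f:C\to C$ with the metric $\max_{x\in C} d(f(x),g(x))$, and let $\mathcal M(C)$ be the space of all Borel probability measures on $C$ with the Prohorov metric $$d_P(\mu,\nu)=\inf\{\delta>0:\ \mu(X)\le\nu(X^\delta)+\delta\ \text{ and }\ \nu(X)\le\mu(X^\delta)+\delta\ \text{ for all Borel } X\subset C\},$$ where $X^\delta=\{x\in C: d(x,X)<\delta\}$. Each $f\in\mathcal C(C)$ induces the continuous map $\tilde f:\mathcal M(C)\to\mathcal M(C)$, $\tilde f(\mu)(X)=\mu(f^{-1}(X))$. For a map $g$ of a metric space $(Z,\rho)$ into itself, a point $x\in Z$ is: *periodic of period $p\ge1$* if $g^p(x)=x$ and $g^j(x)\ne x$ for $1\le j<p$; *recurrent* if every neighbourhood of $x$ contains $g^n(x)$ for infinitely many $n\ge 1$; *nonwandering* if for every neighbourhood $U$ of $x$ there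 is $n\ge1$ with $g^n(U)\cap U\neq\emptyset$; *chain recurrent* if for every $\delta>0$ there are $k\ge1$ and points $x=x_0,x_1,\dots,x_k=x$ with $\rho(g(x_n),x_{n+1})<\delta$ for $0\le n<k$. Let $P(g)$, $R(g)$, $\Omega(g)$, $CR(g)$ be the sets of all periodic, recurrent, nonwandering and chain recurrent points of $g$, respectively. **Theorem.** There is a set $\mathcal N$ of the first category in $\mathcal C(C)$ such that every $f\in\mathcal C(C)\setminus\mathcal N$ has all of the following properties. (a) For each $p\ge1$, $\tilde f$ has uncountably many periodic points of period $p$. (b) For each $p\ge1$, each periodic point $\mu$ of $\tilde f$ of period $p$, each neighbourhood $U$ of $\mu$ in $\mathcal M(C)$ and each $k\ge1$, the set $U$ contains uncountably many periodic points of $\tilde f$ of period $kp$. (c) $R(\tilde f)=\Omega(\tilde f)=CR(\tilde f)$. (d) $CR(\tilde f)\subset\tilde f(\mathcal M(C))$, and $CR(\tilde f)$ has empty interior in $\tilde f(\mathcal M(C))$ (with the relative topology). (e) $P(\tilde f)$ is a dense subset of $CR(\tilde f)$, although $f$ itself has no periodic point: $P(f)=\emptyset$. -/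

import Mathlib

open MeasureTheory Filter Topology Set

noncomputable section

namespace CantorDynamics

/-- The Cantor space `{0,1}^ℕ`. -/
def Cantor : Type := ℕ → Bool

namespace Cantor

/-- The product topology, each factor being discrete. -/
instance : TopologicalSpace Cantor := inferInstanceAs (TopologicalSpace (ℕ → Bool))

instance : CompactSpace Cantor := inferInstanceAs (CompactSpace (ℕ → Bool))

instance : Nonempty Cantor := inferInstanceAs (Nonempty (ℕ → Bool))

instance : MeasurableSpace Cantor := borel Cantor

instance : BorelSpace Cantor := ⟨rfl⟩

open Classical in
/-- `d(x, x) = 0`, and `d(x, y) = 1 / n` for `x ≠ y`, where `n` is the position of the first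
coordinate at which `x` and `y` differ, positions being counted from `1`
(`PiNat.firstDiff` counts them from `0`). -/
def cantorDist (x y : Cantor) : ℝ :=
  if x = y then 0 else 1 / ((PiNat.firstDiff (E := fun _ => Bool) x y : ℝ) + 1)

theorem cantorDist_of_ne {x y : Cantor} (h : x ≠ y) :
    cantorDist x y = 1 / ((PiNat.firstDiff (E := fun _ => Bool) x y : ℝ) + 1) := by
  simp [cantorDist, h]

theorem cantorDist_self (x : Cantor) : cantorDist x x = 0 := by simp [cantorDist]

theorem cantorDist_nonneg (x y : Cantor) : 0 ≤ cantorDist x y := by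
  unfold cantorDist
  split_ifs <;> positivity

theorem cantorDist_comm (x y : Cantor) : cantorDist x y = cantorDist y x := by
  by_cases h : x = y
  · rw [h]
  · have e := PiNat.firstDiff_comm (E := fun _ => Bool) x y
    rw [cantorDist_of_ne h, cantorDist_of_ne (Ne.symm h), e]

theorem cantorDist_triangle (x y z : Cantor) :
    cantorDist x z ≤ cantorDist x y + cantorDist y z := by
  by_cases hxz : x = z
  · subst hxz
    rw [cantorDist_self]
    exact add_nonneg (cantorDist_nonneg _ _) (cantorDist_nonneg _ _)
  by_cases hxy : x = y
  · subst hxy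
    simp [cantorDist_self]
  by_cases hyz : y = z
  · subst hyz
    simp [cantorDist_self]
  have key := PiNat.min_firstDiff_le (E := fun _ => Bool) x y z hxz
  have h1 := cantorDist_nonneg x y
  have h2 := cantorDist_nonneg y z
  rw [cantorDist_of_ne hxz]
  rcases min_le_iff.1 key with h | h
  · have : 1 / ((PiNat.firstDiff (E := fun _ => Bool) x z : ℝ) + 1) ≤ cantorDist x y := by
      rw [cantorDist_of_ne hxy]
      gcongr
    linarith
  · have : 1 / ((PiNat.firstDiff (E := fun _ => Bool) x z : ℝ) + 1) ≤ cantorDist y z := by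
      rw [cantorDist_of_ne hyz]
      gcongr
    linarith

theorem eq_of_cantorDist_eq_zero {x y : Cantor} (h : cantorDist x y = 0) : x = y := by
  by_contra hne
  rw [cantorDist_of_ne hne] at h
  have : 0 < 1 / ((PiNat.firstDiff (E := fun _ => Bool) x y : ℝ) + 1) := by positivity
  exact this.ne' h

theorem cantorDist_lt_iff_mem_cylinder (x y : Cantor) (n : ℕ) :
    cantorDist x y < 1 / ((n : ℝ) + 1) ↔
      y ∈ PiNat.cylinder (E := fun _ => Bool) x (n + 1) := by
  by_cases h : x = y
  · subst h
    rw [cantorDist_self]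
    exact iff_of_true (by positivity) (PiNat.self_mem_cylinder _ _)
  · have e : y ∈ PiNat.cylinder (E := fun _ => Bool) x (n + 1) ↔
        n + 1 ≤ PiNat.firstDiff (E := fun _ => Bool) x y :=
      (PiNat.mem_cylinder_comm (E := fun _ => Bool) x y (n + 1)).trans
        (PiNat.mem_cylinder_iff_le_firstDiff (E := fun _ => Bool) h (n + 1))
    rw [cantorDist_of_ne h, e, one_div_lt_one_div (by positivity) (by positivity),
      add_lt_add_iff_right, Nat.cast_lt, Nat.succ_le_iff]

theorem isOpen_iff_cantorDist (s : Set Cantor) :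
    IsOpen s ↔ ∀ x ∈ s, ∃ ε > 0, ∀ y, cantorDist x y < ε → y ∈ s := by
  constructor
  · intro hs x hx
    obtain ⟨v, ⟨z, n, rfl⟩, hxv, hvs⟩ :=
      (PiNat.isTopologicalBasis_cylinders (fun _ => Bool)).exists_subset_of_mem_open hx hs
    refine ⟨1 / ((n : ℝ) + 1), by positivity, fun y hy => hvs ?_⟩
    rw [cantorDist_lt_iff_mem_cylinder] at hy
    rw [← PiNat.mem_cylinder_iff_eq.1 hxv]
    exact PiNat.cylinder_anti _ (Nat.le_succ n) hy
  · intro h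
    refine (PiNat.isTopologicalBasis_cylinders (fun _ => Bool)).isOpen_iff.2 fun x hx => ?_
    obtain ⟨ε, hε, H⟩ := h x hx
    obtain ⟨n, hn⟩ := exists_nat_one_div_lt hε
    refine ⟨PiNat.cylinder (E := fun _ => Bool) x (n + 1), ⟨x, n + 1, rfl⟩,
      PiNat.self_mem_cylinder _ _, fun y hy => H y ?_⟩
    exact ((cantorDist_lt_iff_mem_cylinder x y n).2 hy).trans hn

/-- The metric `cantorDist`; its topology is (definitionally) the product topology. -/
instance : MetricSpace Cantor :=
  MetricSpace.ofDistTopology cantorDist cantorDist_self cantorDist_comm cantorDist_triangle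
    isOpen_iff_cantorDist fun _ _ => eq_of_cantorDist_eq_zero

end Cantor

/-- The space of Borel probability measures on the Cantor space, with the Prohorov metric. -/
abbrev Meas : Type := LevyProkhorov (ProbabilityMeasure Cantor)

/-- The map induced on probability measures by a continuous map: `μ ↦ μ ∘ f⁻¹`. -/
def induced (f : C(Cantor, Cantor)) (μ : Meas) : Meas :=
  LevyProkhorov.ofMeasure (μ.toMeasure.map f.continuous.measurable.aemeasurable)

/-- The points of (least) period `p`, for `p ≥ 1`. -/
def pointsOfPeriod {X : Type*} (g : X → X) (p : ℕ) : Set X :=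
  {x | Function.minimalPeriod g x = p}

/-- Recurrent points: `x` is a limit point of its own forward orbit, i.e. every neighbourhood of
`x` contains `gⁿ x` for infinitely many `n`. -/
def recurrentSet {X : Type*} [TopologicalSpace X] (g : X → X) : Set X :=
  {x | ∀ U ∈ 𝓝 x, ∃ᶠ n in atTop, g^[n] x ∈ U}

/-- Nonwandering points: every neighbourhood `U` of `x` satisfies `gⁿ(U) ∩ U ≠ ∅` for some
`n ≥ 1`. -/
def nonwanderingSet {X : Type*} [TopologicalSpace X] (g : X → X) : Set X :=
  {x | ∀ U ∈ 𝓝 x, ∃ n : ℕ, 1 ≤ n ∧ (g^[n] '' U ∩ U).Nonempty}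

/-- `c 0, …, c k` is a `δ`-chain of `g` of length `k` from `x` to `y`. -/
def IsChainFromTo {X : Type*} [PseudoMetricSpace X] (g : X → X) (δ : ℝ) (k : ℕ) (x y : X)
    (c : ℕ → X) : Prop :=
  c 0 = x ∧ c k = y ∧ ∀ n < k, dist (g (c n)) (c (n + 1)) < δ

/-- Chain recurrent points: for each `δ > 0` there is a `δ`-chain of positive length from `x`
to `x`. -/
def chainRecurrentSet {X : Type*} [PseudoMetricSpace X] (g : X → X) : Set X :=
  {x | ∀ δ > 0, ∃ k : ℕ, 1 ≤ k ∧ ∃ c : ℕ → X, IsChainFromTo g δ k x x c}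

end CantorDynamics

end

/-! For a generic `f` and every `m` there is a clopen partition of mesh below `1 / (m + 1)` whose
cells `f` maps into one another by a self-map `φ` of a finite set
(`eventually_residual_exists_coding`). Such a condition is open. It is also dense: an approximant
can be made constant on small cells, and coordinates far out, which cost almost no distance, can
carry a label in `ZMod (m + 1) × Fin 4` whose dynamics is prescribed freely.

On cell masses, `induced f` acts as the push-forward by `φ`. A fixed power of `φ` sends every cell
to a periodic one, so a chain recurrent measure gives no mass to the other cells
(`law_preimage_compl_periodicPts_eq_zero`). A common period `L` of the periodic cells preserves all
cell masses of such a measure, so it returns within the mesh bound of itself; this gives (c).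
Replacing its part on each periodic cell by an `f^[L]`-invariant measure on that cell gives a nearby
periodic measure, hence the density in (e).

The labels do the rest. The rotation excludes periodic points of `f` and produces measures of exact
period `m + 1`. The two fixed points of `skew` make two such measures distinct. The transient path
`3 → 2 → 0` yields images of points lying in non-periodic cells; mixing in a little Dirac mass at
such an image leaves the chain recurrent set but not the range, as (d) requires. For (a) and (b),
`(1 - t) μ + t ν`, with `μ` fixed by the `q`-th iterate and `ν` of exact period `q`, has exact
period `q` for all but finitely many `t`. -/

noncomputable section

namespace CantorDynamics

open scoped ENNReal

/-! ### Measures on the Cantor space and the Prohorov distance -/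

/-- The underlying Borel measure of a point of `Meas`. -/
def law (μ : Meas) : Measure Cantor := (μ.toMeasure : Measure Cantor)

instance (μ : Meas) : IsProbabilityMeasure (law μ) :=
  inferInstanceAs (IsProbabilityMeasure (μ.toMeasure : Measure Cantor))

/-- The point of `Meas` with a given underlying measure. -/
def ofLaw (m : Measure Cantor) (h : IsProbabilityMeasure m) : Meas :=
  LevyProkhorov.ofMeasure ⟨m, h⟩

@[simp] theorem law_ofLaw (m : Measure Cantor) (h : IsProbabilityMeasure m) :
    law (ofLaw m h) = m := rfl

theorem law_injective : Function.Injective law := fun _ _ h =>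
  LevyProkhorov.toMeasure_injective (ProbabilityMeasure.toMeasure_injective h)

theorem law_induced (f : C(Cantor, Cantor)) (μ : Meas) :
    law (induced f μ) = (law μ).map f := rfl

theorem law_iterate_induced (f : C(Cantor, Cantor)) (n : ℕ) (μ : Meas) :
    law ((induced f)^[n] μ) = (law μ).map f^[n] := by
  induction n with
  | zero => simp
  | succ n ih =>
    rw [Function.iterate_succ_apply', law_induced, ih, Function.iterate_succ',
      Measure.map_map f.continuous.measurable (f.continuous.iterate n).measurable]

theorem law_iterate_induced_apply (f : C(Cantor, Cantor)) (n : ℕ) (μ : Meas) {A : Set Cantor}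
    (hA : MeasurableSet A) : law ((induced f)^[n] μ) A = law μ (f^[n] ⁻¹' A) := by
  rw [law_iterate_induced, Measure.map_apply (f.continuous.iterate n).measurable hA]

/-- The iterates of a continuous self-map, as continuous maps. -/
def iter (f : C(Cantor, Cantor)) (n : ℕ) : C(Cantor, Cantor) := ⟨f^[n], f.continuous.iterate n⟩

theorem induced_iter (f : C(Cantor, Cantor)) (n : ℕ) (μ : Meas) :
    induced (iter f n) μ = (induced f)^[n] μ :=
  law_injective <| by rw [law_iterate_induced]; rfl

theorem continuous_induced (f : C(Cantor, Cantor)) : Continuous (induced f) :=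
  LevyProkhorov.continuous_ofMeasure_probabilityMeasure.comp
    ((ProbabilityMeasure.continuous_map f.continuous).comp
      LevyProkhorov.continuous_toMeasure_probabilityMeasure)

instance : CompactSpace Meas :=
  (LevyProkhorov.probabilityMeasureHomeomorph (Ω := Cantor)).compactSpace

theorem dist_le_of_forall_thickening {μ ν : Meas} {δ : ℝ} (hδ : 0 ≤ δ)
    (h : ∀ ε A, δ < ε → MeasurableSet A →
      law μ A ≤ law ν (Metric.thickening ε A) + ENNReal.ofReal ε) : dist μ ν ≤ δ :=
  levyProkhorovDist_le_of_forall_le (law μ) (law ν) hδ h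

theorem dist_le_of_forall_le_add {μ ν : Meas} {δ : ℝ} (hδ : 0 ≤ δ)
    (h : ∀ A, MeasurableSet A → law μ A ≤ law ν A + ENNReal.ofReal δ) : dist μ ν ≤ δ :=
  dist_le_of_forall_thickening hδ fun _ A hε hA => (h A hA).trans <|
    add_le_add (measure_mono (Metric.self_subset_thickening (hδ.trans_lt hε) A))
      (ENNReal.ofReal_le_ofReal hε.le)

theorem law_le_of_dist_lt {μ ν : Meas} {δ : ℝ} (h : dist μ ν < δ) {A : Set Cantor}
    (hA : MeasurableSet A) :
    law μ A ≤ law ν (Metric.thickening δ A) + ENNReal.ofReal δ := by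
  have hδ : 0 < δ := dist_nonneg.trans_lt h
  have h' : levyProkhorovEDist (law μ) (law ν) < ENNReal.ofReal δ :=
    (ENNReal.lt_ofReal_iff_toReal_lt (levyProkhorovEDist_ne_top _ _)).2 h
  simpa [ENNReal.toReal_ofReal hδ.le] using left_measure_le_of_levyProkhorovEDist_lt h' hA

/-- By compactness a small thickening of a clopen set stays inside it, so the Prohorov inequality
holds with no enlargement of the set. -/
theorem exists_forall_law_le_add {A : Set Cantor} (hA : IsClopen A) :
    ∃ δ₀ > 0, ∀ δ ≤ δ₀, ∀ μ ν : Meas, dist μ ν < δ → law μ A ≤ law ν A + ENNReal.ofReal δ := by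
  obtain ⟨δ₀, h0, h⟩ := hA.isClosed.isCompact.exists_thickening_subset_open hA.isOpen subset_rfl
  exact ⟨δ₀, h0, fun δ hδ μ ν hd => (law_le_of_dist_lt hd hA.isOpen.measurableSet).trans <|
    add_le_add_left (measure_mono ((Metric.thickening_mono hδ A).trans h)) _⟩

/-! ### Convex combinations -/

/-- A finite convex combination of measures. -/
def convexComb {ι : Type*} [Fintype ι] (w : ι → ℝ≥0∞) (hw : ∑ i, w i = 1) (ν : ι → Meas) : Meas :=
  ofLaw (∑ i, w i • law (ν i)) ⟨by simp [hw]⟩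

theorem law_convexComb {ι : Type*} [Fintype ι] (w : ι → ℝ≥0∞) (hw : ∑ i, w i = 1)
    (ν : ι → Meas) : law (convexComb w hw ν) = ∑ i, w i • law (ν i) := rfl

theorem law_convexComb_apply {ι : Type*} [Fintype ι] (w : ι → ℝ≥0∞) (hw : ∑ i, w i = 1)
    (ν : ι → Meas) (A : Set Cantor) :
    law (convexComb w hw ν) A = ∑ i, w i * law (ν i) A := by
  simp [law_convexComb]

theorem induced_convexComb (f : C(Cantor, Cantor)) {ι : Type*} [Fintype ι] (w : ι → ℝ≥0∞)
    (hw : ∑ i, w i = 1) (ν : ι → Meas) :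
    induced f (convexComb w hw ν) = convexComb w hw fun i => induced f (ν i) := by
  refine law_injective (Measure.ext fun A hA => ?_)
  rw [law_induced, Measure.map_apply f.continuous.measurable hA, law_convexComb_apply,
    law_convexComb_apply]
  refine Finset.sum_congr rfl fun i _ => ?_
  rw [law_induced, Measure.map_apply f.continuous.measurable hA]

theorem iterate_induced_convexComb (f : C(Cantor, Cantor)) (n : ℕ) {ι : Type*} [Fintype ι]
    (w : ι → ℝ≥0∞) (hw : ∑ i, w i = 1) (ν : ι → Meas) :
    (induced f)^[n] (convexComb w hw ν) = convexComb w hw fun i => (induced f)^[n] (ν i) := by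
  simp_rw [← induced_iter, induced_convexComb]

/-- The measure `(1 - t) μ + t ν`, the parameter being truncated to `[0, 1]`. -/
def mix (t : ℝ) (μ ν : Meas) : Meas :=
  convexComb (fun b : Bool => bif b then min (ENNReal.ofReal t) 1 else 1 - min (ENNReal.ofReal t) 1)
    (by simp) (fun b => bif b then ν else μ)

theorem iterate_induced_mix (f : C(Cantor, Cantor)) (n : ℕ) (t : ℝ) (μ ν : Meas) :
    (induced f)^[n] (mix t μ ν) = mix t ((induced f)^[n] μ) ((induced f)^[n] ν) := by
  rw [mix, iterate_induced_convexComb, mix]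
  congr 1
  ext b
  cases b <;> rfl

theorem law_mix_apply {t : ℝ} (ht : t ∈ Icc (0 : ℝ) 1) (μ ν : Meas) (A : Set Cantor) :
    law (mix t μ ν) A = ENNReal.ofReal t * law ν A + ENNReal.ofReal (1 - t) * law μ A := by
  have h1 : ENNReal.ofReal t ≤ 1 := by simpa using ht.2
  rw [mix, law_convexComb_apply, Fintype.sum_bool, ENNReal.ofReal_sub _ ht.1]
  simp [h1]

theorem law_mix_real {t : ℝ} (ht : t ∈ Icc (0 : ℝ) 1) (μ ν : Meas) (A : Set Cantor) :
    (law (mix t μ ν)).real A = t * (law ν).real A + (1 - t) * (law μ).real A := by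
  rw [measureReal_def, law_mix_apply ht, ENNReal.toReal_add (by finiteness) (by finiteness),
    ENNReal.toReal_mul, ENNReal.toReal_mul, ENNReal.toReal_ofReal ht.1,
    ENNReal.toReal_ofReal (by linarith [ht.2])]
  rfl

theorem dist_mix_le {t : ℝ} (ht : t ∈ Icc (0 : ℝ) 1) (μ ν : Meas) : dist (mix t μ ν) μ ≤ t := by
  refine dist_le_of_forall_le_add ht.1 fun A _ => ?_
  rw [law_mix_apply ht, add_comm]
  refine add_le_add (mul_le_of_le_one_left' ?_) (mul_le_of_le_one_right' prob_le_one)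
  simpa using ht.1

theorem eq_of_forall_real {μ ν : Meas}
    (h : ∀ A, MeasurableSet A → (law μ).real A = (law ν).real A) : μ = ν :=
  law_injective <| Measure.ext fun A hA => (measureReal_eq_measureReal_iff).1 (h A hA)

theorem mix_injOn {μ ν : Meas} (h : ν ≠ μ) : InjOn (fun t => mix t μ ν) (Icc 0 1) := by
  intro s hs t ht hst
  by_contra hne
  refine h (eq_of_forall_real fun A _ => ?_)
  have h1 := law_mix_real hs μ ν A
  have h2 := law_mix_real ht μ ν A
  simp only at hst
  rw [hst, h2] at h1
  have h3 : (s - t) * ((law ν).real A - (law μ).real A) = 0 := by linarith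
  rcases mul_eq_zero.1 h3 with h3 | h3
  · exact absurd (sub_eq_zero.1 h3) hne
  · exact sub_eq_zero.1 h3

/-- If `ν' ≠ ν`, then `(1 - t) μ + t ν = (1 - t) μ' + t ν'` for at most one `t`. -/
theorem subsingleton_mix_eq_mix {μ ν μ' ν' : Meas} (h : ν' ≠ ν) :
    {t ∈ Icc (0 : ℝ) 1 | mix t μ' ν' = mix t μ ν}.Subsingleton := by
  rintro s ⟨hs, hs'⟩ t ⟨ht, ht'⟩
  by_contra hne
  refine h (eq_of_forall_real fun A _ => ?_)
  have h1 := law_mix_real hs μ ν A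
  have h2 := law_mix_real ht μ ν A
  rw [← hs', law_mix_real hs] at h1
  rw [← ht', law_mix_real ht] at h2
  set b := (law ν').real A - (law ν).real A with hb
  set a := (law μ').real A - (law μ).real A with ha
  have e1 : s * b + (1 - s) * a = 0 := by rw [hb, ha]; linarith
  have e2 : t * b + (1 - t) * a = 0 := by rw [hb, ha]; linarith
  -- An affine function with two distinct zeros vanishes identically; `b` is its value at `1`.
  have e3 : (s - t) * (b - a) = 0 := by linarith
  rcases mul_eq_zero.1 e3 with e3 | e3
  · exact absurd (sub_eq_zero.1 e3) hne
  · have : b = 0 := by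
      rw [sub_eq_zero.1 e3] at e1 ⊢
      linarith
    exact sub_eq_zero.1 this

/-! ### Invariant measures -/

/-- The Dirac measure at a point. -/
def diracMeas (x : Cantor) : Meas := ofLaw (Measure.dirac x) inferInstance

theorem law_diracMeas (x : Cantor) : law (diracMeas x) = Measure.dirac x := rfl

theorem induced_diracMeas (f : C(Cantor, Cantor)) (x : Cantor) :
    induced f (diracMeas x) = diracMeas (f x) :=
  law_injective (Measure.map_dirac' f.continuous.measurable x)

/-- Averages of the Dirac measures along the first `n + 1` points of an orbit. -/
def orbitAverage (h : C(Cantor, Cantor)) (x : Cantor) (n : ℕ) : Meas :=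
  convexComb (fun _ : Fin (n + 1) => ((n + 1 : ℕ) : ℝ≥0∞)⁻¹)
    (by
      rw [Finset.sum_const, Finset.card_univ, Fintype.card_fin, nsmul_eq_mul]
      exact ENNReal.mul_inv_cancel (by simp) (by finiteness))
    fun i => diracMeas (h^[i] x)

/-- The two averages share all terms but one each, and each term has weight `1 / (n + 1)`. -/
theorem dist_induced_orbitAverage_le (h : C(Cantor, Cantor)) (x : Cantor) (n : ℕ) :
    dist (induced h (orbitAverage h x n)) (orbitAverage h x n) ≤ 1 / ((n : ℝ) + 1) := by
  have hpos : (0 : ℝ) < (n : ℝ) + 1 := by positivity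
  have hinv : ENNReal.ofReal (1 / ((n : ℝ) + 1)) = ((n + 1 : ℕ) : ℝ≥0∞)⁻¹ := by
    rw [one_div, ENNReal.ofReal_inv_of_pos hpos]
    congr 1
    exact_mod_cast ENNReal.ofReal_natCast (n + 1)
  refine dist_le_of_forall_le_add (by positivity) fun A _ => ?_
  rw [hinv, orbitAverage, induced_convexComb, law_convexComb_apply, law_convexComb_apply,
    ← Finset.mul_sum, ← Finset.mul_sum]
  have e : ∀ i, induced h (diracMeas (h^[i] x)) = diracMeas (h^[i + 1] x) := fun i => by
    rw [induced_diracMeas, Function.iterate_succ_apply']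
  simp_rw [e]
  rw [Fin.sum_univ_eq_sum_range (fun i => law (diracMeas (h^[i + 1] x)) A) (n + 1),
    Fin.sum_univ_eq_sum_range (fun i => law (diracMeas (h^[i] x)) A) (n + 1),
    Finset.sum_range_succ, Finset.sum_range_succ', mul_add, mul_add]
  refine add_le_add le_self_add ?_
  exact mul_le_of_le_one_right' prob_le_one

/-- Krylov–Bogoliubov: a nonempty clopen forward-invariant set carries an invariant measure. -/
theorem exists_invariant (h : C(Cantor, Cantor)) {A : Set Cantor} (hA : IsClopen A)
    (hne : A.Nonempty) (hm : MapsTo h A A) : ∃ ν : Meas, induced h ν = ν ∧ law ν A = 1 := by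
  obtain ⟨x, hx⟩ := hne
  have hmass : ∀ n, law (orbitAverage h x n) A = 1 := fun n => by
    rw [orbitAverage, law_convexComb_apply]
    have e : ∀ i, law (diracMeas (h^[i] x)) A = 1 := fun i => by
      rw [law_diracMeas, Measure.dirac_apply_of_mem (hm.iterate i hx)]
    simp_rw [e, mul_one]
    rw [Finset.sum_const, Finset.card_univ, Fintype.card_fin, nsmul_eq_mul]
    exact ENNReal.mul_inv_cancel (by simp) (by finiteness)
  obtain ⟨ν, u, hu, hν⟩ := CompactSpace.tendsto_subseq (orbitAverage h x)
  refine ⟨ν, ?_, ?_⟩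
  · have h1 : Tendsto (fun n => dist (induced h (orbitAverage h x (u n))) (orbitAverage h x (u n)))
        atTop (𝓝 (dist (induced h ν) ν)) :=
      (((continuous_induced h).tendsto ν).comp hν).dist hν
    have h2 : Tendsto (fun n => dist (induced h (orbitAverage h x (u n))) (orbitAverage h x (u n)))
        atTop (𝓝 0) :=
      squeeze_zero (fun _ => dist_nonneg) (fun n => dist_induced_orbitAverage_le h x (u n))
        (tendsto_one_div_add_atTop_nhds_zero_nat.comp hu.tendsto_atTop)
    exact dist_eq_zero.1 (tendsto_nhds_unique h1 h2)
  · refine le_antisymm prob_le_one ?_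
    -- Full mass on `A` survives the limit because `A` is clopen.
    obtain ⟨δ₀, h0, hδ⟩ := exists_forall_law_le_add hA
    refine ENNReal.le_of_forall_pos_le_add fun ε hε _ => ?_
    have hd : 0 < min δ₀ (ε : ℝ) := lt_min h0 hε
    obtain ⟨n, hn⟩ := ((Metric.tendsto_nhds.1 hν) _ hd).exists
    have := hδ _ (min_le_left _ _) _ _ hn
    rw [Function.comp_apply, hmass] at this
    refine this.trans (add_le_add_right ?_ _)
    calc ENNReal.ofReal (min δ₀ ε) ≤ ENNReal.ofReal ε := ENNReal.ofReal_le_ofReal (min_le_right _ _)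
      _ = ε := ENNReal.ofReal_coe_nnreal

/-! ### Finite dynamical systems -/

theorem exists_common_period {T : Type*} [Finite T] (φ : T → T) :
    ∃ L ≥ 1, ∀ t ∈ Function.periodicPts φ, φ^[L] t = t := by
  have := Fintype.ofFinite T
  -- The minimal period of a non-periodic point is `0` by convention; `max 1` keeps the product
  -- positive.
  refine ⟨∏ t, max 1 (Function.minimalPeriod φ t),
    Nat.succ_le_of_lt (Finset.prod_pos fun t _ => by positivity), fun t ht => ?_⟩
  have h1 : max 1 (Function.minimalPeriod φ t) = Function.minimalPeriod φ t :=
    max_eq_right (Function.minimalPeriod_pos_of_mem_periodicPts ht)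
  have h2 := Finset.dvd_prod_of_mem (fun t => max 1 (Function.minimalPeriod φ t))
    (Finset.mem_univ t)
  simp only [h1] at h2
  exact ((Function.isPeriodicPt_minimalPeriod φ t).trans_dvd h2)

theorem iterate_mem_periodicPts {T : Type*} {φ : T → T} {t : T}
    (ht : t ∈ Function.periodicPts φ) (n : ℕ) : φ^[n] t ∈ Function.periodicPts φ := by
  obtain ⟨k, hk, h⟩ := ht
  exact ⟨k, hk, h.apply_iterate n⟩

theorem exists_iterate_mem_periodicPts {T : Type*} [Finite T] (φ : T → T) :
    ∃ N, ∀ t, φ^[N] t ∈ Function.periodicPts φ := by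
  have := Fintype.ofFinite T
  have h : ∀ t, ∃ n, φ^[n] t ∈ Function.periodicPts φ := fun t => by
    obtain ⟨i, j, hij, h⟩ := Finite.exists_ne_map_eq_of_infinite fun n => φ^[n] t
    wlog hlt : i < j generalizing i j
    · exact this j i hij.symm h.symm (by omega)
    refine ⟨i, j - i, by omega, ?_⟩
    change φ^[j - i] (φ^[i] t) = φ^[i] t
    rw [← Function.iterate_add_apply, Nat.sub_add_cancel hlt.le]
    exact h.symm
  choose n hn using h
  -- The sum dominates every entry time, and the periodic points are forward invariant.
  refine ⟨∑ t, n t, fun t => ?_⟩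
  have : ∑ t, n t = (∑ t, n t - n t) + n t :=
    (Nat.sub_add_cancel (Finset.single_le_sum (f := n) (fun _ _ => Nat.zero_le _)
      (Finset.mem_univ t))).symm
  rw [this, Function.iterate_add_apply]
  exact iterate_mem_periodicPts (hn t) _

/-- A self-map of four points with two fixed points and a point whose image is not periodic. -/
def skew : Fin 4 → Fin 4 := ![0, 1, 0, 2]

theorem skew_iterate_two_ne {k : ℕ} (hk : k ≠ 0) : skew^[k] 2 ≠ 2 := by
  obtain ⟨k, rfl⟩ := Nat.exists_eq_succ_of_ne_zero hk
  have h : Function.IsFixedPt skew 0 := rfl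
  rw [Function.iterate_succ_apply, show skew 2 = 0 from rfl, (h.iterate k).eq]
  decide

/-! ### Codings by finite systems -/

/-- A clopen partition of the Cantor space of mesh less than `1 / (m + 1)`, indexed by a finite
set `T`, with a self-map `φ` of `T` that factors onto the rotation of `ZMod (m + 1)` and onto
`skew`. -/
structure Coding (m : ℕ) where
  /-- The index set of the partition. -/
  T : Type
  fintypeT : Fintype T
  /-- The map sending a point to the index of its cell. -/
  π : Cantor → T
  isClopen_fiber : ∀ t, IsClopen (π ⁻¹' {t})
  surjective : Function.Surjective π
  dist_lt : ∀ x y, π x = π y → dist x y < 1 / ((m : ℝ) + 1)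
  /-- The self-map of the index set. -/
  φ : T → T
  /-- The factor map onto the rotation. -/
  κ : T → ZMod (m + 1)
  κ_φ : ∀ t, κ (φ t) = κ t + 1
  /-- The factor map onto `skew`. -/
  σ : T → Fin 4
  σ_φ : ∀ t, σ (φ t) = skew (σ t)
  exists_label : ∀ i j, ∃ t, κ t = i ∧ σ t = j

attribute [instance] Coding.fintypeT

namespace Coding

variable {m : ℕ} (c : Coding m)

/-- The coding is a semiconjugacy from `f` to `φ`. -/
def Codes (f : Cantor → Cantor) : Prop := ∀ x, c.π (f x) = c.φ (c.π x)

theorem isClopen_preimage (S : Set c.T) : IsClopen (c.π ⁻¹' S) := by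
  rw [← biUnion_of_singleton S, preimage_iUnion₂]
  exact S.toFinite.isClopen_biUnion fun t _ => c.isClopen_fiber t

theorem measurableSet_preimage (S : Set c.T) : MeasurableSet (c.π ⁻¹' S) :=
  (c.isClopen_preimage S).isOpen.measurableSet

variable {c}

theorem Codes.iterate {f : Cantor → Cantor} (hf : c.Codes f) (n : ℕ) (x : Cantor) :
    c.π (f^[n] x) = c.φ^[n] (c.π x) :=
  Function.Semiconj.iterate_right (f := c.π) hf n x

theorem κ_iterate (n : ℕ) (t : c.T) : c.κ (c.φ^[n] t) = c.κ t + n := by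
  induction n with
  | zero => simp
  | succ n ih => rw [Function.iterate_succ_apply', c.κ_φ, ih]; push_cast; ring

theorem σ_iterate (n : ℕ) (t : c.T) : c.σ (c.φ^[n] t) = skew^[n] (c.σ t) :=
  Function.Semiconj.iterate_right (f := c.σ) c.σ_φ n t

theorem φ_notMem_periodicPts {t : c.T} (ht : c.σ t = 3) :
    c.φ t ∉ Function.periodicPts c.φ := by
  rintro ⟨k, hk, h⟩
  have h2 : c.σ (c.φ t) = 2 := by rw [c.σ_φ, ht]; rfl
  have h3 := σ_iterate k (c.φ t)
  rw [h.eq, h2] at h3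
  exact skew_iterate_two_ne hk.ne' h3.symm

/-- This amounts to finitely many conditions sending a compact cell into an open cell, each open in
the compact-open topology. -/
theorem isOpen_setOf_codes (c : Coding m) : IsOpen {f : C(Cantor, Cantor) | c.Codes f} := by
  have : {f : C(Cantor, Cantor) | c.Codes f} =
      ⋂ t, {f : C(Cantor, Cantor) | MapsTo f (c.π ⁻¹' {t}) (c.π ⁻¹' {c.φ t})} := by
    ext f
    simp only [mem_iInter]
    exact ⟨fun h t x hx => (h x).trans (congrArg _ hx), fun h x => h (c.π x) rfl⟩
  rw [this]
  exact isOpen_iInter_of_finite fun t => ContinuousMap.isOpen_setOfPred_mapsTo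
    (c.isClopen_fiber t).isClosed.isCompact (c.isClopen_fiber _).isOpen

end Coding

/-! ### Density of coded maps -/

theorem dist_lt_of_forall_eq {x y : Cantor} {n : ℕ} (h : ∀ i < n + 1, x i = y i) :
    dist x y < 1 / ((n : ℝ) + 1) :=
  (Cantor.cantorDist_lt_iff_mem_cylinder x y n).2 fun i hi => (h i hi).symm

/-- A 0-1 code for the elements of a finite type. -/
def bitCode {Λ : Type*} [Fintype Λ] (l : Λ) (j : Fin (Fintype.card Λ)) : Bool :=
  decide (j = Fintype.equivFin Λ l)

theorem bitCode_injective {Λ : Type*} [Fintype Λ] : Function.Injective (bitCode (Λ := Λ)) := by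
  intro a b h
  have := congrFun h (Fintype.equivFin Λ a)
  simpa [bitCode] using this

/-- The first `n` bits of a sequence, followed by a label coded in later bits. -/
def readCell (n : ℕ) (Λ : Type*) [Fintype Λ] [Nonempty Λ] (x : Cantor) : (Fin n → Bool) × Λ :=
  (fun i => x i, Function.invFun bitCode fun j : Fin (Fintype.card Λ) => x (n + j))

/-- A sequence with given first `n` bits and given label. -/
def writeCell (n : ℕ) {Λ : Type*} [Fintype Λ] (p : (Fin n → Bool) × Λ) : Cantor := fun i =>
  if h : i < n then p.1 ⟨i, h⟩
  else if h' : i - n < Fintype.card Λ then bitCode p.2 ⟨i - n, h'⟩ else false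

theorem readCell_writeCell (n : ℕ) {Λ : Type*} [Fintype Λ] [Nonempty Λ]
    (p : (Fin n → Bool) × Λ) : readCell n Λ (writeCell n p) = p := by
  refine Prod.ext (funext fun i => by simp [readCell, writeCell]) ?_
  have : (fun j : Fin (Fintype.card Λ) => writeCell n p (n + j)) = bitCode p.2 :=
    funext fun j => by simp [writeCell]
  simp only [readCell, this]
  exact Function.leftInverse_invFun bitCode_injective _

theorem isClopen_readCell_preimage (n : ℕ) (Λ : Type*) [Fintype Λ] [Nonempty Λ]
    (S : Set ((Fin n → Bool) × Λ)) : IsClopen (readCell n Λ ⁻¹' S) := by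
  have hc : Continuous fun x : Cantor =>
      ((fun i => x i, fun j => x (n + j)) : (Fin n → Bool) × (Fin (Fintype.card Λ) → Bool)) := by
    have h : ∀ i : ℕ, Continuous fun x : Cantor => x i :=
      fun i => continuous_apply (A := fun _ : ℕ => Bool) i
    have h1 : Continuous fun (x : Cantor) (i : Fin n) => x i := continuous_pi fun i => h i
    have h2 : Continuous fun (x : Cantor) (j : Fin (Fintype.card Λ)) => x (n + j) :=
      continuous_pi fun j => h (n + j)
    exact h1.prodMk h2
  exact (isClopen_discrete ((fun q => (q.1, Function.invFun bitCode q.2)) ⁻¹' S)).preimage hc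

theorem exists_coding_dist_lt (m : ℕ) (f : C(Cantor, Cantor)) {ε : ℝ} (hε : 0 < ε) :
    ∃ c : Coding m, ∃ g : C(Cantor, Cantor), c.Codes g ∧ dist f g < ε := by
  obtain ⟨δ, hδ, hu⟩ := Metric.uniformContinuous_iff.1
    (CompactSpace.uniformContinuous_of_continuous f.continuous) (ε / 2) (half_pos hε)
  obtain ⟨n, hn⟩ := exists_nat_one_div_lt
    (lt_min hδ (lt_min (half_pos hε) (by positivity : 0 < 1 / ((m : ℝ) + 1))))
  obtain ⟨hn1, hn2, hn3⟩ : 1 / ((n : ℝ) + 1) < δ ∧ 1 / ((n : ℝ) + 1) < ε / 2 ∧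
      1 / ((n : ℝ) + 1) < 1 / ((m : ℝ) + 1) := by
    simpa only [lt_min_iff] using hn
  let Λ := ZMod (m + 1) × Fin 4
  let π := readCell (n + 1) Λ
  let s : (Fin (n + 1) → Bool) × Λ → Cantor := writeCell (n + 1)
  have hπs : ∀ p, π (s p) = p := readCell_writeCell (n + 1)
  -- The leading bits follow `f` at the sample point `s p` of the cell; the label evolves
  -- independently of `f`.
  let φ : (Fin (n + 1) → Bool) × Λ → (Fin (n + 1) → Bool) × Λ :=
    fun p => ((π (f (s p))).1, p.2.1 + 1, skew p.2.2)
  have hclose : ∀ x y, (π x).1 = (π y).1 → dist x y < 1 / ((n : ℝ) + 1) := fun x y h =>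
    dist_lt_of_forall_eq fun i hi => congrFun h ⟨i, hi⟩
  let c : Coding m :=
    { T := (Fin (n + 1) → Bool) × Λ
      fintypeT := inferInstance
      π := π
      isClopen_fiber := fun t => isClopen_readCell_preimage _ _ _
      surjective := fun p => ⟨s p, hπs p⟩
      dist_lt := fun x y h => (hclose x y (congrArg _ h)).trans hn3
      φ := φ
      κ := fun p => p.2.1
      κ_φ := fun _ => rfl
      σ := fun p => p.2.2
      σ_φ := fun _ => rfl
      exists_label := fun i j => ⟨(fun _ => false, i, j), rfl, rfl⟩ }
  have hcont : Continuous fun x => s (φ (π x)) :=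
    ⟨fun U _ => (isClopen_readCell_preimage (n + 1) Λ ((fun p => s (φ p)) ⁻¹' U)).isOpen⟩
  refine ⟨c, ⟨_, hcont⟩, fun x => hπs _, (ContinuousMap.dist_lt_iff hε).2 fun x => ?_⟩
  -- Moving to the sample point costs `ε / 2` by uniform continuity; overwriting the bits after the
  -- first `n + 1` costs another `ε / 2`.
  have h1 : dist (f x) (f (s (π x))) < ε / 2 :=
    hu ((hclose _ _ (by rw [hπs])).trans hn1)
  have h2 : dist (f (s (π x))) (s (φ (π x))) < ε / 2 :=
    (hclose _ _ (by rw [hπs])).trans hn2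
  exact (dist_triangle _ _ _).trans_lt (by simpa using add_lt_add h1 h2)

theorem eventually_residual_exists_coding :
    ∀ᶠ f : C(Cantor, Cantor) in residual C(Cantor, Cantor),
      ∀ m, ∃ c : Coding m, c.Codes f := by
  refine eventually_countable_forall.2 fun m => residual_of_dense_open ?_ ?_
  · have : {f : C(Cantor, Cantor) | ∃ c : Coding m, c.Codes f} =
        ⋃ c : Coding m, {f : C(Cantor, Cantor) | c.Codes f} := by
      ext f; simp
    change IsOpen {f : C(Cantor, Cantor) | ∃ c : Coding m, c.Codes f}
    rw [this]
    exact isOpen_iUnion fun c => c.isOpen_setOf_codes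
  · refine Metric.dense_iff.2 fun f ε hε => ?_
    obtain ⟨c, g, hg, hd⟩ := exists_coding_dist_lt m f hε
    exact ⟨g, by rwa [Metric.mem_ball, dist_comm], c, hg⟩

/-! ### Recurrence for general maps -/

theorem recurrentSet_subset_nonwanderingSet {X : Type*} [TopologicalSpace X] (g : X → X) :
    recurrentSet g ⊆ nonwanderingSet g := fun x hx U hU => by
  obtain ⟨n, hn, h⟩ := frequently_atTop.1 (hx U hU) 1
  exact ⟨n, hn, _, ⟨x, mem_of_mem_nhds hU, rfl⟩, h⟩

theorem nonwanderingSet_subset_chainRecurrentSet {X : Type*} [PseudoMetricSpace X] {g : X → X}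
    (hg : Continuous g) : nonwanderingSet g ⊆ chainRecurrentSet g := fun x hx δ hδ => by
  have hU : Metric.ball x (δ / 2) ∩ g ⁻¹' Metric.ball (g x) (δ / 2) ∈ 𝓝 x :=
    inter_mem (Metric.ball_mem_nhds x (half_pos hδ))
      (hg.continuousAt (Metric.ball_mem_nhds _ (half_pos hδ)))
  obtain ⟨n, hn, _, ⟨y, hy, rfl⟩, hy'⟩ := hx _ hU
  have h0 : dist (g y) (g x) < δ / 2 := hy.2
  have h1 : dist (g^[n] y) x < δ / 2 := hy'.1
  -- The chain is the returning orbit of `y` with both ends moved to `x`. For `n = 1` both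
  -- corrections fall on the same step, hence the halves of `δ`.
  refine ⟨n, hn, fun i => if i = 0 ∨ i = n then x else g^[i] y, by simp, by simp, fun i hi => ?_⟩
  have e1 : dist (g (if i = 0 ∨ i = n then x else g^[i] y)) (g^[i + 1] y) < δ / 2 := by
    rcases Nat.eq_zero_or_pos i with rfl | hpos
    · simpa [dist_comm] using h0
    · rw [if_neg (by omega), Function.iterate_succ_apply', dist_self]
      exact half_pos hδ
  beta_reduce
  by_cases hin : i + 1 = n
  · rw [if_pos (Or.inr hin)]
    rw [hin] at e1
    linarith [dist_triangle (g (if i = 0 ∨ i = n then x else g^[i] y)) (g^[n] y) x]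
  · rw [if_neg (c := i + 1 = 0 ∨ i + 1 = n) (by omega)]
    linarith

theorem periodicPts_subset_recurrentSet {X : Type*} [TopologicalSpace X] (g : X → X) :
    Function.periodicPts g ⊆ recurrentSet g := fun x ⟨p, hp, h⟩ U hU =>
  frequently_atTop.2 fun N => ⟨p * N, Nat.le_mul_of_pos_left N hp, by
    rw [(h.mul_const N).eq]; exact mem_of_mem_nhds hU⟩

/-! ### Measures and codings -/

namespace Coding

variable {m : ℕ} {c : Coding m} {f : C(Cantor, Cantor)}

/-- The union of the cells meeting `A` lies in every thickening of `A` by more than the mesh bound.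
-/
theorem dist_le_of_law_preimage_eq (c : Coding m) {μ ν : Meas}
    (h : ∀ S : Set c.T, law μ (c.π ⁻¹' S) = law ν (c.π ⁻¹' S)) :
    dist μ ν ≤ 1 / ((m : ℝ) + 1) := by
  refine dist_le_of_forall_thickening (by positivity) fun ε A hε _ => ?_
  calc law μ A ≤ law μ (c.π ⁻¹' (c.π '' A)) := measure_mono (subset_preimage_image _ _)
    _ = law ν (c.π ⁻¹' (c.π '' A)) := h _
    _ ≤ law ν (Metric.thickening ε A) := measure_mono fun x ⟨y, hy, hyx⟩ =>
        Metric.mem_thickening_iff.2 ⟨y, hy, (c.dist_lt x y hyx.symm).trans hε⟩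
    _ ≤ _ := le_self_add

theorem dist_le_of_law_fiber_eq (c : Coding m) {μ ν : Meas}
    (h : ∀ t, law μ (c.π ⁻¹' {t}) = law ν (c.π ⁻¹' {t})) :
    dist μ ν ≤ 1 / ((m : ℝ) + 1) := by
  classical
  refine c.dist_le_of_law_preimage_eq fun S => ?_
  have e : S = ((S.toFinite.toFinset : Finset c.T) : Set c.T) := by simp
  rw [e, ← sum_measure_preimage_singleton _ fun t _ => c.measurableSet_preimage {t},
    ← sum_measure_preimage_singleton _ fun t _ => c.measurableSet_preimage {t}]
  exact Finset.sum_congr rfl fun t _ => h t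

theorem law_iterate_preimage (hf : c.Codes f) (n : ℕ) (μ : Meas) (S : Set c.T) :
    law ((induced f)^[n] μ) (c.π ⁻¹' S) = law μ (c.π ⁻¹' (c.φ^[n] ⁻¹' S)) := by
  rw [law_iterate_induced_apply f n μ (c.measurableSet_preimage S)]
  congr 1
  ext x
  simp [hf.iterate n x]

/-- A measure carried by the periodic cells returns near itself along multiples of a common
period. -/
theorem exists_dist_iterate_le (hf : c.Codes f) {μ : Meas}
    (hμ : law μ (c.π ⁻¹' (Function.periodicPts c.φ)ᶜ) = 0) :
    ∃ L ≥ 1, ∀ j, dist ((induced f)^[L * j] μ) μ ≤ 1 / ((m : ℝ) + 1) := by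
  obtain ⟨L, hL, h⟩ := exists_common_period c.φ
  refine ⟨L, hL, fun j => c.dist_le_of_law_preimage_eq fun S => ?_⟩
  rw [law_iterate_preimage hf]
  refine measure_congr ?_
  have hae : ∀ᵐ x ∂law μ, c.π x ∈ Function.periodicPts c.φ := by
    rw [ae_iff]; exact hμ
  filter_upwards [hae] with x hx
  have e : c.φ^[L * j] (c.π x) = c.π x := by
    rw [Function.iterate_mul]
    exact Function.IsFixedPt.iterate (h _ hx) j
  exact propext (by
    change c.φ^[L * j] (c.π x) ∈ S ↔ c.π x ∈ S
    rw [e])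

/-- Each jump adds at most `δ` to the mass of a union of cells. Only finitely many such unions occur
in `N` steps, so `δ₀` does not depend on the chain. -/
theorem exists_chain_bound (hf : c.Codes f) (N : ℕ) (S : Set c.T) :
    ∃ δ₀ > 0, ∀ δ ≤ δ₀, ∀ e : ℕ → Meas, (∀ i, dist (induced f (e i)) (e (i + 1)) < δ) →
      law (e N) (c.π ⁻¹' S) ≤ law (e 0) (c.π ⁻¹' (c.φ^[N] ⁻¹' S)) + N * ENNReal.ofReal δ := by
  induction N generalizing S with
  | zero => exact ⟨1, one_pos, fun δ _ e _ => by simp⟩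
  | succ N ih =>
    obtain ⟨δ₁, h1, H1⟩ := ih (c.φ ⁻¹' S)
    obtain ⟨δ₂, h2, H2⟩ := exists_forall_law_le_add (c.isClopen_preimage S)
    refine ⟨min δ₁ δ₂, lt_min h1 h2, fun δ hδ e he => ?_⟩
    have a1 := H1 δ (hδ.trans (min_le_left _ _)) e he
    have a2 := H2 δ (hδ.trans (min_le_right _ _)) (e (N + 1)) (induced f (e N))
      (by rw [dist_comm]; exact he N)
    have a3 := law_iterate_preimage hf 1 (e N) S
    simp only [Function.iterate_one] at a3
    rw [a3] at a2
    refine a2.trans ((add_le_add_left a1 _).trans_eq ?_)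
    rw [Function.iterate_succ', preimage_comp]
    push_cast
    ring

/-- Only the last `N` steps before a return to `μ` matter: mass present earlier has reached periodic
cells, so the remaining mass is at most `N * δ`, whatever the length of the chain. -/
theorem law_preimage_compl_periodicPts_eq_zero (hf : c.Codes f) {μ : Meas}
    (hμ : μ ∈ chainRecurrentSet (induced f)) :
    law μ (c.π ⁻¹' (Function.periodicPts c.φ)ᶜ) = 0 := by
  obtain ⟨N, hN⟩ := exists_iterate_mem_periodicPts c.φ
  obtain ⟨δ₀, h0, H⟩ := exists_chain_bound hf N (Function.periodicPts c.φ)ᶜ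
  have hempty : c.φ^[N] ⁻¹' (Function.periodicPts c.φ)ᶜ = ∅ :=
    eq_empty_of_forall_notMem fun t ht => ht (hN t)
  have key : ∀ δ, 0 < δ → δ ≤ δ₀ →
      law μ (c.π ⁻¹' (Function.periodicPts c.φ)ᶜ) ≤ N * ENNReal.ofReal δ := by
    intro δ hδ hδ0
    obtain ⟨k, hk, d, d0, dk, hd⟩ := hμ δ hδ
    -- The closed chain is repeated periodically, since its length `k` may be less than `N`.
    have hstep : ∀ i, dist (induced f (d (i % k))) (d ((i + 1) % k)) < δ := fun i => by
      have hlt := Nat.mod_lt i hk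
      have hi := hd (i % k) hlt
      rcases Nat.lt_or_ge (i % k + 1) k with h | h
      · rwa [← Nat.mod_eq_of_lt h, Nat.mod_add_mod] at hi
      · have h' : i % k + 1 = k := by omega
        rw [h', dk, ← d0] at hi
        rwa [← Nat.mod_add_mod, h', Nat.mod_self]
    -- The shift makes the time after `N` steps equal to `N * k`, where the chain is at `μ`.
    have := H δ hδ0 (fun i => d ((i + N * (k - 1)) % k)) fun i => by
      have := hstep (i + N * (k - 1))
      rwa [show i + 1 + N * (k - 1) = i + N * (k - 1) + 1 by ring]
    have e : N + N * (k - 1) = N * k := by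
      obtain ⟨k, rfl⟩ := Nat.exists_eq_add_of_le' hk
      simp; ring
    simpa [e, d0, hempty] using this
  refine le_antisymm ?_ bot_le
  have hlim : Tendsto (fun δ : ℝ => (N : ℝ≥0∞) * ENNReal.ofReal δ) (𝓝[>] 0) (𝓝 0) := by
    have h1 : Tendsto ENNReal.ofReal (𝓝[>] 0) (𝓝 0) := by
      simpa using (ENNReal.continuous_ofReal.tendsto 0).mono_left nhdsWithin_le_nhds
    simpa using ENNReal.Tendsto.const_mul h1 (Or.inr (ENNReal.natCast_ne_top N))
  refine ge_of_tendsto hlim ?_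
  filter_upwards [Ioc_mem_nhdsGT h0] with δ hδ using key δ hδ.1 hδ.2

/-- The measures of exact period `m + 1`, one for each fixed point of `skew`. -/
theorem exists_periodic (hf : c.Codes f) {s : Fin 4} (hs : skew s = s) :
    ∃ ν : Meas, Function.minimalPeriod (induced f) ν = m + 1 ∧
      law ν (c.π ⁻¹' (c.σ ⁻¹' {s})) = 1 := by
  obtain ⟨t, ht, ht'⟩ := c.exists_label 0 s
  obtain ⟨x, rfl⟩ := c.surjective t
  -- A measure invariant under the return map to one rotation class has period dividing `m + 1`.
  have hm : MapsTo (iter f (m + 1)) (c.π ⁻¹' {t | c.κ t = 0 ∧ c.σ t = s})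
      (c.π ⁻¹' {t | c.κ t = 0 ∧ c.σ t = s}) := by
    rintro y ⟨hy, hy'⟩
    change c.κ (c.π (f^[m + 1] y)) = 0 ∧ c.σ (c.π (f^[m + 1] y)) = s
    rw [hf.iterate, κ_iterate, σ_iterate, hy, hy', zero_add]
    exact ⟨by exact_mod_cast ZMod.natCast_self (m + 1), Function.iterate_fixed hs _⟩
  obtain ⟨ν, hν, hν1⟩ := exists_invariant (iter f (m + 1)) (c.isClopen_preimage {t | c.κ t = 0 ∧ c.σ t = s})
    ⟨x, ht, ht'⟩ hm
  rw [induced_iter] at hν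
  have hν2 : law ν (c.π ⁻¹' {t | c.κ t = 0}) = 1 :=
    le_antisymm prob_le_one (hν1.symm.le.trans (measure_mono fun y hy => hy.1))
  refine ⟨ν, ?_, le_antisymm prob_le_one (hν1.symm.le.trans (measure_mono fun y hy => hy.2))⟩
  have hper : Function.IsPeriodicPt (induced f) (m + 1) ν := hν
  refine Nat.dvd_antisymm hper.minimalPeriod_dvd ?_
  rw [← ZMod.natCast_eq_zero_iff]
  by_contra hne
  set j := Function.minimalPeriod (induced f) ν with hj
  -- Pulling the class `0` back by `j` steps gives the class `-j`; two disjoint classes cannot both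
  -- have full mass.
  have h1 : law ν (c.π ⁻¹' {t | c.κ t = (-j : ZMod (m + 1))}) = 1 := by
    have := law_iterate_preimage hf j ν {t | c.κ t = 0}
    rw [Function.iterate_minimalPeriod, hν2] at this
    rw [this]
    congr 1
    ext y
    simp [κ_iterate, eq_neg_iff_add_eq_zero]
  have hdisj : Disjoint (c.π ⁻¹' {t | c.κ t = 0}) (c.π ⁻¹' {t | c.κ t = (-j : ZMod (m + 1))}) :=
    disjoint_left.2 fun y (hy : _ = _) (hy' : _ = _) => hne (by
      rw [hy] at hy'; exact neg_eq_zero.1 hy'.symm)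
  have h2 := measure_union (μ := law ν) hdisj (c.measurableSet_preimage _)
  rw [hν2, h1] at h2
  exact absurd (h2 ▸ prob_le_one : (1 + 1 : ℝ≥0∞) ≤ 1) (by norm_num)

end Coding

/-! ### Properties of maps with arbitrarily fine codings -/

variable {f : C(Cantor, Cantor)}

theorem chainRecurrentSet_subset_recurrentSet (hf : ∀ m, ∃ c : Coding m, c.Codes f) :
    chainRecurrentSet (induced f) ⊆ recurrentSet (induced f) := fun μ hμ U hU => by
  obtain ⟨ε, hε, hεU⟩ := Metric.mem_nhds_iff.1 hU
  obtain ⟨m, hm⟩ := exists_nat_one_div_lt hε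
  obtain ⟨c, hc⟩ := hf m
  obtain ⟨L, hL, h⟩ := c.exists_dist_iterate_le hc (c.law_preimage_compl_periodicPts_eq_zero hc hμ)
  exact frequently_atTop.2 fun N =>
    ⟨L * N, Nat.le_mul_of_pos_left N hL, hεU ((h N).trans_lt hm)⟩

theorem recurrentSet_eq_nonwanderingSet (hf : ∀ m, ∃ c : Coding m, c.Codes f) :
    recurrentSet (induced f) = nonwanderingSet (induced f) :=
  (recurrentSet_subset_nonwanderingSet _).antisymm <|
    (nonwanderingSet_subset_chainRecurrentSet (continuous_induced f)).trans
      (chainRecurrentSet_subset_recurrentSet hf)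

theorem nonwanderingSet_eq_chainRecurrentSet (hf : ∀ m, ∃ c : Coding m, c.Codes f) :
    nonwanderingSet (induced f) = chainRecurrentSet (induced f) :=
  (nonwanderingSet_subset_chainRecurrentSet (continuous_induced f)).antisymm <|
    (chainRecurrentSet_subset_recurrentSet hf).trans (recurrentSet_subset_nonwanderingSet _)

/-- The range is compact, hence closed, and a recurrent point is a limit of its iterates. -/
theorem chainRecurrentSet_subset_range (hf : ∀ m, ∃ c : Coding m, c.Codes f) :
    chainRecurrentSet (induced f) ⊆ range (induced f) := fun μ hμ => by
  rw [← (isCompact_range (continuous_induced f)).isClosed.closure_eq]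
  refine mem_closure_iff_nhds.2 fun U hU => ?_
  obtain ⟨n, hn, h⟩ := frequently_atTop.1 (chainRecurrentSet_subset_recurrentSet hf hμ U hU) 1
  obtain ⟨n, rfl⟩ := Nat.exists_eq_add_of_le' hn
  exact ⟨_, h, (induced f)^[n] μ, (Function.iterate_succ_apply' _ _ _).symm⟩

theorem interior_preimage_chainRecurrentSet_eq_empty (hf : ∀ m, ∃ c : Coding m, c.Codes f) :
    interior ((↑) ⁻¹' chainRecurrentSet (induced f) : Set (range (induced f))) = ∅ := by
  refine eq_empty_of_forall_notMem ?_
  rintro ⟨_, μ, rfl⟩ hμ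
  obtain ⟨ε, hε, H⟩ := Metric.mem_nhds_iff.1 (mem_interior_iff_mem_nhds.1 hμ)
  obtain ⟨c, hc⟩ := hf 0
  obtain ⟨t, -, ht⟩ := c.exists_label 0 3
  obtain ⟨x, rfl⟩ := c.surjective t
  set r := min (ε / 2) 1 with hr
  have hr0 : 0 < r := lt_min (half_pos hε) one_pos
  have hrI : r ∈ Icc (0 : ℝ) 1 := ⟨hr0.le, min_le_right _ _⟩
  have e : induced f (mix r μ (diracMeas x)) = mix r (induced f μ) (diracMeas (f x)) := by
    simpa [induced_diracMeas] using iterate_induced_mix f 1 r μ (diracMeas x)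
  have hmem : mix r (induced f μ) (diracMeas (f x)) ∈ chainRecurrentSet (induced f) :=
    -- The perturbed measure stays in the range because `e` exhibits it as the image of a mixture.
    @H ⟨_, _, e⟩ ((dist_mix_le hrI _ _).trans_lt
      ((min_le_left _ _).trans_lt (half_lt_self hε)))
  have h0 := c.law_preimage_compl_periodicPts_eq_zero hc hmem
  have hx : f x ∈ c.π ⁻¹' (Function.periodicPts c.φ)ᶜ := by
    change c.π (f x) ∉ _
    rw [hc x]
    exact Coding.φ_notMem_periodicPts ht
  rw [law_mix_apply hrI, law_diracMeas, Measure.dirac_apply_of_mem hx] at h0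
  simp only [mul_one, add_eq_zero, ENNReal.ofReal_eq_zero] at h0
  linarith [h0.1]

theorem periodicPts_eq_empty (hf : ∀ m, ∃ c : Coding m, c.Codes f) :
    Function.periodicPts f = ∅ := by
  refine eq_empty_of_forall_notMem fun x ⟨n, hn, h⟩ => ?_
  -- A point with `f^[n] x = x` would force `n = 0` in `ZMod (n + 1)`.
  obtain ⟨c, hc⟩ := hf n
  have h1 := Coding.κ_iterate n (c.π x)
  rw [← hc.iterate, h.eq] at h1
  have h2 : ((n : ℕ) : ZMod (n + 1)) = 0 := left_eq_add.1 h1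
  rw [ZMod.natCast_eq_zero_iff] at h2
  exact absurd (Nat.le_of_dvd hn h2) (by omega)

theorem chainRecurrentSet_subset_closure_periodicPts (hf : ∀ m, ∃ c : Coding m, c.Codes f) :
    chainRecurrentSet (induced f) ⊆ closure (Function.periodicPts (induced f)) := fun μ hμ => by
  classical
  refine Metric.mem_closure_iff.2 fun ε hε => ?_
  obtain ⟨m, hm⟩ := exists_nat_one_div_lt hε
  obtain ⟨c, hc⟩ := hf m
  obtain ⟨L, hL, h⟩ := exists_common_period c.φ
  have hν : ∀ t, ∃ ν : Meas, (induced f)^[L] ν = ν ∧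
      (t ∈ Function.periodicPts c.φ → law ν (c.π ⁻¹' {t}) = 1) := fun t => by
    by_cases ht : t ∈ Function.periodicPts c.φ
    · obtain ⟨ν, h1, h2⟩ := exists_invariant (iter f L) (c.isClopen_fiber t)
        (c.surjective t) fun x (hx : c.π x = t) => by
          change c.π (f^[L] x) = t
          rw [hc.iterate, hx, h t ht]
      exact ⟨ν, induced_iter f L ν ▸ h1, fun _ => h2⟩
    -- Non-periodic cells get weight zero, so any invariant measure will do here.
    · obtain ⟨ν, h1, -⟩ := exists_invariant (iter f L) isClopen_univ univ_nonempty
        (mapsTo_univ _ _)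
      exact ⟨ν, induced_iter f L ν ▸ h1, fun h => absurd h ht⟩
  choose ν hν1 hν2 using hν
  have h0 := c.law_preimage_compl_periodicPts_eq_zero hc hμ
  have hw : ∑ t, law μ (c.π ⁻¹' {t}) = 1 := by
    rw [sum_measure_preimage_singleton _ fun t _ => c.measurableSet_preimage {t}]
    simp
  refine ⟨convexComb _ hw ν, ⟨L, hL, ?_⟩, ?_⟩
  · change (induced f)^[L] _ = _
    rw [iterate_induced_convexComb]
    simp_rw [hν1]
  · refine (c.dist_le_of_law_fiber_eq fun s => ?_).trans_lt hm
    rw [law_convexComb_apply, Finset.sum_eq_single s]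
    · by_cases hs : s ∈ Function.periodicPts c.φ
      · rw [hν2 s hs, mul_one]
      · rw [measure_mono_null (preimage_mono (singleton_subset_iff.2 hs)) h0, zero_mul]
    · intro t _ hts
      by_cases ht : t ∈ Function.periodicPts c.φ
      · have hz : law (ν t) (c.π ⁻¹' {s}) = 0 := by
          refine measure_mono_null (t := (c.π ⁻¹' {t})ᶜ) ?_
            ((prob_compl_eq_zero_iff (c.measurableSet_preimage {t})).2 (hν2 t ht))
          rintro x (hx : c.π x = s) (hx' : c.π x = t)
          exact hts (hx'.symm.trans hx)
        rw [hz, mul_zero]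
      · rw [measure_mono_null (preimage_mono (singleton_subset_iff.2 ht)) h0, zero_mul]
    · simp

theorem exists_ne_minimalPeriod_eq (hf : ∀ m, ∃ c : Coding m, c.Codes f) {q : ℕ} (hq : 1 ≤ q)
    (μ : Meas) : ∃ ν ≠ μ, Function.minimalPeriod (induced f) ν = q := by
  obtain ⟨m, rfl⟩ := Nat.exists_eq_add_of_le' hq
  obtain ⟨c, hc⟩ := hf m
  obtain ⟨ν₀, h0, h0'⟩ := c.exists_periodic hc (s := 0) rfl
  obtain ⟨ν₁, h1, h1'⟩ := c.exists_periodic hc (s := 1) rfl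
  by_cases hμ : ν₀ = μ
  · refine ⟨ν₁, fun h => ?_, h1⟩
    rw [h, ← hμ] at h1'
    have hdisj : Disjoint (c.π ⁻¹' (c.σ ⁻¹' {0})) (c.π ⁻¹' (c.σ ⁻¹' {1})) :=
      ((disjoint_singleton.2 (by decide)).preimage _).preimage _
    have h2 := measure_union (μ := law ν₀) hdisj (c.measurableSet_preimage _)
    rw [h0', h1'] at h2
    exact absurd (h2 ▸ prob_le_one : (1 + 1 : ℝ≥0∞) ≤ 1) (by norm_num)
  · exact ⟨ν₀, hμ, h0⟩

/-- The number `q` need not be the least period of `μ`; this freedom yields the multiples `k * p` in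
(b). -/
theorem not_countable_inter_pointsOfPeriod (hf : ∀ m, ∃ c : Coding m, c.Codes f) {q : ℕ}
    (hq : 1 ≤ q) {μ : Meas} (hμ : (induced f)^[q] μ = μ) {U : Set Meas} (hU : U ∈ 𝓝 μ) :
    ¬ (U ∩ pointsOfPeriod (induced f) q).Countable := by
  intro hcount
  obtain ⟨ν, hne, hν⟩ := exists_ne_minimalPeriod_eq hf hq μ
  obtain ⟨ε, hε, hεU⟩ := Metric.mem_nhds_iff.1 hU
  -- `F j` collects the parameters at which the mixture is fixed by the `j`-th iterate. For `0 < j <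
  -- q` the measure `ν` is moved, so `F j` has at most one element.
  set F := fun j : ℕ => {t ∈ Icc (0 : ℝ) 1 |
    mix t ((induced f)^[j] μ) ((induced f)^[j] ν) = mix t μ ν} with hF
  have hFfin : (⋃ j ∈ Ioo 0 q, F j).Countable := by
    refine (to_countable (Ioo 0 q)).biUnion fun j hj => (subsingleton_mix_eq_mix ?_).countable
    intro h
    have : q ∣ j := hν ▸ (show Function.IsPeriodicPt (induced f) j ν from h).minimalPeriod_dvd
    exact absurd (Nat.le_of_dvd hj.1 this) (not_le.2 hj.2)
  have hsub : Ioo 0 (min ε 1) \ ⋃ j ∈ Ioo 0 q, F j ⊆ Icc (0 : ℝ) 1 := fun t ht =>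
    ⟨ht.1.1.le, ht.1.2.le.trans (min_le_right _ _)⟩
  have hmaps : MapsTo (fun t => mix t μ ν) (Ioo 0 (min ε 1) \ ⋃ j ∈ Ioo 0 q, F j)
      (U ∩ pointsOfPeriod (induced f) q) := by
    intro t ht
    have htI := hsub ht
    refine ⟨hεU ((dist_mix_le htI μ ν).trans_lt (ht.1.2.trans_le (min_le_left _ _))), ?_⟩
    have hper : Function.IsPeriodicPt (induced f) q (mix t μ ν) := by
      change (induced f)^[q] _ = _
      rw [iterate_induced_mix, hμ, ← hν, Function.iterate_minimalPeriod]
    have hpos := hper.minimalPeriod_pos hq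
    refine le_antisymm (hper.minimalPeriod_le hq) (not_lt.1 fun hlt => ht.2 ?_)
    refine mem_biUnion (x := Function.minimalPeriod (induced f) (mix t μ ν)) ⟨hpos, hlt⟩
      ⟨htI, ?_⟩
    rw [← iterate_induced_mix, Function.iterate_minimalPeriod]
  have h1 := hmaps.countable_of_injOn ((mix_injOn hne).mono hsub) hcount
  have h2 : (Ioo 0 (min ε 1)).Countable :=
    (h1.union hFfin).mono (by rw [sdiff_union_self]; exact subset_union_left)
  exact absurd (Cardinal.Real.Ioo_countable_iff.1 h2) (not_le.2 (lt_min hε one_pos))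

end CantorDynamics

end

theorem theorem5p1 :
    ∀ᶠ f : C(CantorDynamics.Cantor, CantorDynamics.Cantor) in
      residual C(CantorDynamics.Cantor, CantorDynamics.Cantor),
      -- (a)
      (∀ p : ℕ, 1 ≤ p →
        ¬ (CantorDynamics.pointsOfPeriod (CantorDynamics.induced f) p).Countable) ∧
      -- (b)
      (∀ p : ℕ, 1 ≤ p →
        ∀ μ ∈ CantorDynamics.pointsOfPeriod (CantorDynamics.induced f) p,
        ∀ U ∈ 𝓝 μ, ∀ k : ℕ, 1 ≤ k →
          ¬ (U ∩ CantorDynamics.pointsOfPeriod (CantorDynamics.induced f) (k * p)).Countable) ∧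
      -- (c)
      (CantorDynamics.recurrentSet (CantorDynamics.induced f) =
          CantorDynamics.nonwanderingSet (CantorDynamics.induced f) ∧
        CantorDynamics.nonwanderingSet (CantorDynamics.induced f) =
          CantorDynamics.chainRecurrentSet (CantorDynamics.induced f)) ∧
      -- (d): empty interior relative to the range, and the set does lie in the range
      (CantorDynamics.chainRecurrentSet (CantorDynamics.induced f) ⊆
          range (CantorDynamics.induced f) ∧
        interior ((↑) ⁻¹' CantorDynamics.chainRecurrentSet (CantorDynamics.induced f) :
          Set (range (CantorDynamics.induced f))) = ∅) ∧
      -- (e)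
      (Function.periodicPts (CantorDynamics.induced f) ⊆
          CantorDynamics.chainRecurrentSet (CantorDynamics.induced f) ∧
        CantorDynamics.chainRecurrentSet (CantorDynamics.induced f) ⊆
          closure (Function.periodicPts (CantorDynamics.induced f)) ∧
        Function.periodicPts f = ∅) := by
  filter_upwards [CantorDynamics.eventually_residual_exists_coding] with f hf
  refine ⟨fun p hp => ?_, fun p hp μ hμ U hU k hk => ?_,
    ⟨CantorDynamics.recurrentSet_eq_nonwanderingSet hf,
      CantorDynamics.nonwanderingSet_eq_chainRecurrentSet hf⟩,
    ⟨CantorDynamics.chainRecurrentSet_subset_range hf,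
      CantorDynamics.interior_preimage_chainRecurrentSet_eq_empty hf⟩,
    ?_, CantorDynamics.chainRecurrentSet_subset_closure_periodicPts hf,
    CantorDynamics.periodicPts_eq_empty hf⟩
  -- Only the existence of `ν` is needed; the Dirac measure is a dummy.
  · obtain ⟨ν, -, hν⟩ := CantorDynamics.exists_ne_minimalPeriod_eq hf hp
      (CantorDynamics.diracMeas (Classical.arbitrary _))
    have := CantorDynamics.not_countable_inter_pointsOfPeriod hf hp
      (hν ▸ Function.iterate_minimalPeriod : _ = ν) univ_mem
    rwa [univ_inter] at this
  · have h : Function.minimalPeriod (CantorDynamics.induced f) μ = p := hμ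
    refine CantorDynamics.not_countable_inter_pointsOfPeriod hf (Nat.mul_pos hk hp) ?_ hU
    exact Function.IsPeriodicPt.const_mul
      (h ▸ Function.isPeriodicPt_minimalPeriod (CantorDynamics.induced f) μ) k
  · rw [← CantorDynamics.nonwanderingSet_eq_chainRecurrentSet hf,
      ← CantorDynamics.recurrentSet_eq_nonwanderingSet hf]
    exact CantorDynamics.periodicPts_subset_recurrentSet _
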